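/- Let $X$ be a non-empty chain (linearly ordered set) and let $\mathrm{Aut}(X)$ be the group of its order automorphisms. A non-empty order-convex set $J\subseteq X$ is a regular interval if for all $x,y\in J$ and $g\in \mathrm{Aut}(X)$, $gx\in J$ implies $gy\in J$. Assume that $X$ is simple: $\mathrm{Aut}(X)$ acts transitively on $X$ ($X$ is homogeneous), and the only regular intervals are the single points and $X$. Here $X$ is rigid if for all $x,y\in X$ there is exactly one $g\in\mathrm{Aut}(X)$ with $gx=y$; it is ultrahomogeneous if for all $n$ and all $x_1<\dots<x_n$, $y_1<\dots<y_n$ in $X$ there is $g\in\mathrm{Aut}(X)$ with $gx_k=y_k$ for $k=1,\dots,n$. The topology $\tau_\partial$ on $\mathrm{Aut}(X)$ is the permutation topology (pointwise convergence with $X$ discrete), and $\tau_p$ is the topology of pointwise convergence with $X$ carrying its order topology; both are group topologies. A topological group is Roelcke precompact if its Roelcke uniformity $L\wedge R$ (the greatest lower bound of the left and right uniformities, i.e. the finest uniformity coarser than both) is totally bounded. A homogeneous GO-space on $X$ is $(X,\sigma)$, where $\sigma$ is a topology on $X$ that refines the order topology, has a base of order-convex sets, and for which all elements of $\mathrm{Aut}(X)$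 are homeomorphisms. A group topology on $\mathrm{Aut}(X)$ is admissible for $(X,\sigma)$ if the action $\mathrm{Aut}(X)\times (X,\sigma)\to (X,\sigma)$ is continuous. (1) Suppose that $X$ has more than one point. Then $X$ is rigid if and only if, for every homogeneous GO-space $(X,\sigma)$ on $X$, $\mathrm{Aut}(X)$ is Roelcke precompact in no group topology admissible for $(X,\sigma)$. Moreover, this holds on each space separately: for every homogeneous GO-space $(X,\sigma)$ on $X$, $X$ is rigid if and only if $\mathrm{Aut}(X)$ is Roelcke precompact in no group topology admissible for $(X,\sigma)$. (2) $X$ is ultrahomogeneous $\iff$ $(\mathrm{Aut}(X),\tau_\partial)$ is Roelcke precompact $\iff$ $(\mathrm{Aut}(X),\tau_p)$ is Roelcke precompact. (3) $(\mathrm{Aut}(X),\tau_\partial)$ is Roelcke precompact if and only if $(\mathrm{Aut}(X),\tau_p)$ is Roelcke precompact. -/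

import Mathlib

open Set Filter Topology

/-! ### The Roelcke uniformity and Roelcke precompactness -/

/-- The Roelcke uniformity `L ∧ R` of a topological group: the finest uniformity that is coarser
than both the left and the right uniformity. (Mathlib writes `u ≤ v` for "`u` is finer than `v`",
so the greatest common coarsening is the supremum.) -/
@[reducible]
def roelckeUniformSpace (G : Type*) [Group G] [TopologicalSpace G] [IsTopologicalGroup G] :
    UniformSpace G :=
  IsTopologicalGroup.leftUniformSpace G ⊔ IsTopologicalGroup.rightUniformSpace G

/-- The standard base of the Roelcke uniformity: the entourages `{(x, y) | y ∈ V x V}`, where `V`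
runs through the neighbourhoods of the unit. -/
theorem hasBasis_roelcke (G : Type*) [Group G] [TopologicalSpace G] [IsTopologicalGroup G] :
    (@uniformity G (roelckeUniformSpace G)).HasBasis (fun V : Set G => V ∈ 𝓝 1)
      fun V => {p : G × G | ∃ a ∈ V, ∃ b ∈ V, p.2 = a * p.1 * b} := by
  let S : Set G → Set (G × G) := fun V => {p | ∃ a ∈ V, ∃ b ∈ V, p.2 = a * p.1 * b}
  have hS : Monotone S := fun V W hVW p ⟨a, ha, b, hb, h⟩ => ⟨a, hVW ha, b, hVW hb, h⟩
  let C : UniformSpace.Core G :=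
    { uniformity := (𝓝 1).lift' S
      refl := by
        refine le_lift'.2 fun V hV => ?_
        rw [mem_principal]
        rintro ⟨x, y⟩ (rfl : x = y)
        exact ⟨1, mem_of_mem_nhds hV, 1, mem_of_mem_nhds hV, by simp⟩
      symm := by
        refine tendsto_lift'.2 fun V hV => ?_
        filter_upwards [mem_lift' (f := 𝓝 (1 : G)) (h := S) (inv_mem_nhds_one G hV)]
        rintro ⟨x, y⟩ ⟨a, ha, b, hb, h⟩
        refine ⟨a⁻¹, ha, b⁻¹, hb, ?_⟩
        simp only [Prod.fst_swap, Prod.snd_swap] at h ⊢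
        rw [h]
        group
      comp := by
        refine le_lift'.2 fun V hV => ?_
        obtain ⟨W, hW, hWV⟩ := exists_nhds_one_split hV
        refine mem_of_superset (mem_lift' (mem_lift' hW)) ?_
        rintro ⟨x, z⟩ ⟨y, ⟨a, ha, b, hb, h⟩, ⟨c, hc, d, hd, h'⟩⟩
        refine ⟨c * a, hWV c hc a ha, b * d, hWV b hb d hd, ?_⟩
        simp only at h h' ⊢
        rw [h', h]
        group }
  have hle : roelckeUniformSpace G ≤ UniformSpace.ofCore C := by
    refine sup_le ?_ ?_
    · refine le_lift'.2 fun V hV => ?_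
      refine mem_of_superset (preimage_mem_comap hV) ?_
      rintro ⟨x, y⟩ h
      exact ⟨1, mem_of_mem_nhds hV, x⁻¹ * y, h, by simp⟩
    · refine le_lift'.2 fun V hV => ?_
      refine mem_of_superset (preimage_mem_comap hV) ?_
      rintro ⟨x, y⟩ h
      exact ⟨y * x⁻¹, h, 1, mem_of_mem_nhds hV, by simp⟩
  constructor
  intro E
  constructor
  · intro hE
    obtain ⟨E', hE', hEE⟩ := @comp_mem_uniformity_sets G (roelckeUniformSpace G) E hE
    have hL : E' ∈ @uniformity G (IsTopologicalGroup.leftUniformSpace G) :=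
      (show IsTopologicalGroup.leftUniformSpace G ≤ roelckeUniformSpace G from le_sup_left) hE'
    have hR : E' ∈ @uniformity G (IsTopologicalGroup.rightUniformSpace G) :=
      (show IsTopologicalGroup.rightUniformSpace G ≤ roelckeUniformSpace G from le_sup_right) hE'
    obtain ⟨V, hV, hVE⟩ := mem_comap.1 hL
    obtain ⟨W, hW, hWE⟩ := mem_comap.1 hR
    refine ⟨V ∩ W, inter_mem hV hW, ?_⟩
    rintro ⟨x, y⟩ ⟨a, ha, b, hb, h⟩
    simp only at h
    refine hEE ⟨a * x, hWE ?_, hVE ?_⟩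
    · simpa using ha.2
    · have h2 : (a * x)⁻¹ * y = b := by rw [h]; group
      change (a * x)⁻¹ * y ∈ V
      rw [h2]
      exact hb.1
  · rintro ⟨V, hV, hVE⟩
    exact hle (mem_of_superset (mem_lift' (f := 𝓝 (1 : G)) (h := S) hV) hVE)

/-- A group topology is Roelcke precompact if its Roelcke uniformity is totally bounded. -/
def GroupTopology.IsRoelckePrecompact {G : Type*} [Group G] (τ : GroupTopology G) : Prop :=
  @TotallyBounded G (@roelckeUniformSpace G _ τ.toTopologicalSpace τ.toIsTopologicalGroup) univ

/-! ### Topologies on the automorphism group of a chain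

The automorphism group `Aut(X)` of a chain `X` is `X ≃o X`, with composition as multiplication. -/

/-- The topology of pointwise convergence on `Aut(X)` with respect to a topology `σ` on `X`:
the coarsest topology for which all maps `g ↦ g x` into `(X, σ)` are continuous. Its subbase
consists of the sets `{g | g x ∈ O}` with `x : X` and `O` open in `(X, σ)`. -/
@[reducible]
def autPointwise (X : Type*) [LinearOrder X] (σ : TopologicalSpace X) :
    TopologicalSpace (X ≃o X) :=
  ⨅ x : X, σ.induced fun g : X ≃o X => g x

theorem continuous_autPointwise_iff {X : Type*} [LinearOrder X] {σ : TopologicalSpace X}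
    {Y : Type*} [tY : TopologicalSpace Y] {F : Y → (X ≃o X)} :
    @Continuous Y (X ≃o X) tY (autPointwise X σ) F ↔
      ∀ x, @Continuous Y X tY σ fun y => F y x := by
  let : TopologicalSpace (X ≃o X) := autPointwise X σ
  exact continuous_iInf_rng.trans (forall_congr' fun x => continuous_induced_rng)

theorem continuous_autPointwise_apply {X : Type*} [LinearOrder X] {σ : TopologicalSpace X}
    (x : X) : @Continuous (X ≃o X) X (autPointwise X σ) σ fun g => g x :=
  @continuous_autPointwise_iff X _ σ (X ≃o X) (autPointwise X σ) id |>.1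
    (@continuous_id _ (autPointwise X σ)) x

theorem isTopologicalGroup_autPointwise_bot (X : Type*) [LinearOrder X] :
    @IsTopologicalGroup (X ≃o X) (autPointwise X ⊥) _ := by
  let tX : TopologicalSpace X := ⊥
  have : DiscreteTopology X := ⟨rfl⟩
  let : TopologicalSpace (X ≃o X) := autPointwise X ⊥
  have hev : ∀ x y : X, IsOpen {g : X ≃o X | g x = y} := fun x y =>
    (isOpen_discrete ({y} : Set X)).preimage (continuous_autPointwise_apply (σ := ⊥) x)
  have hmul : Continuous fun p : (X ≃o X) × (X ≃o X) => p.1 * p.2 := by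
    refine continuous_autPointwise_iff.2 fun x => continuous_def.2 fun O _ => ?_
    rw [isOpen_iff_mem_nhds]
    rintro ⟨f, g⟩ hfg
    refine mem_of_superset (((hev (g x) (f (g x))).prod (hev x (g x))).mem_nhds ⟨rfl, rfl⟩) ?_
    rintro ⟨f', g'⟩ ⟨hf, hg⟩
    have h1 : f' (g x) = f (g x) := hf
    have h2 : g' x = g x := hg
    change f' (g' x) ∈ O
    rw [h2, h1]
    exact hfg
  have hinv : Continuous fun g : X ≃o X => g⁻¹ := by
    refine continuous_autPointwise_iff.2 fun x => continuous_def.2 fun O _ => ?_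
    rw [isOpen_iff_mem_nhds]
    intro f hf
    refine mem_of_superset ((hev (f⁻¹ x) x).mem_nhds (RelIso.apply_inv_self f x)) ?_
    intro g hg
    have h1 : g (f⁻¹ x) = x := hg
    have h2 : g⁻¹ x = f⁻¹ x := by
      rw [← RelIso.inv_apply_self g (f⁻¹ x), h1]
    change g⁻¹ x ∈ O
    rw [h2]
    exact hf
  exact { continuous_mul := hmul, continuous_inv := hinv }

theorem isTopologicalGroup_autPointwise_order (X : Type*) [LinearOrder X] :
    @IsTopologicalGroup (X ≃o X) (autPointwise X (Preorder.topology X)) _ := by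
  let tX : TopologicalSpace X := Preorder.topology X
  have : OrderTopology X := ⟨rfl⟩
  let : TopologicalSpace (X ≃o X) := autPointwise X (Preorder.topology X)
  have hlt : ∀ x a : X, IsOpen {g : X ≃o X | g x < a} := fun x a =>
    (isOpen_Iio (a := a)).preimage (continuous_autPointwise_apply (σ := tX) x)
  have hgt : ∀ x a : X, IsOpen {g : X ≃o X | a < g x} := fun x a =>
    (isOpen_Ioi (a := a)).preimage (continuous_autPointwise_apply (σ := tX) x)
  have hmul : Continuous fun p : (X ≃o X) × (X ≃o X) => p.1 * p.2 := by
    refine continuous_autPointwise_iff.2 fun x => continuous_generateFrom_iff.2 ?_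
    rintro s ⟨a, rfl | rfl⟩ <;> rw [isOpen_iff_mem_nhds] <;> rintro ⟨f, g⟩ hfg
    · replace hfg : a < f (g x) := hfg
      by_cases hc : ∃ c, c < g x ∧ a < f c
      · obtain ⟨c, hc1, hc2⟩ := hc
        refine mem_of_superset (((hgt c a).prod (hgt x c)).mem_nhds ⟨hc2, hc1⟩) ?_
        rintro ⟨f', g'⟩ ⟨h1, h2⟩
        exact lt_trans (show a < f' c from h1) (f'.strictMono h2)
      · push Not at hc
        have hy : f.symm a < g x := by rwa [OrderIso.symm_apply_lt]
        refine mem_of_superset (((hgt (g x) a).prod (hgt x (f.symm a))).mem_nhds ⟨hfg, hy⟩) ?_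
        rintro ⟨f', g'⟩ ⟨h1, h2⟩
        have h3 : g x ≤ g' x := by
          by_contra! h
          have h4 : f.symm a < g' x := h2
          exact absurd (hc _ h) (not_le.2 (by rwa [OrderIso.symm_apply_lt] at h4))
        exact lt_of_lt_of_le (show a < f' (g x) from h1) (f'.monotone h3)
    · replace hfg : f (g x) < a := hfg
      by_cases hc : ∃ c, g x < c ∧ f c < a
      · obtain ⟨c, hc1, hc2⟩ := hc
        refine mem_of_superset (((hlt c a).prod (hlt x c)).mem_nhds ⟨hc2, hc1⟩) ?_
        rintro ⟨f', g'⟩ ⟨h1, h2⟩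
        exact lt_trans (f'.strictMono h2) (show f' c < a from h1)
      · push Not at hc
        have hy : g x < f.symm a := by rwa [OrderIso.lt_symm_apply]
        refine mem_of_superset (((hlt (g x) a).prod (hlt x (f.symm a))).mem_nhds ⟨hfg, hy⟩) ?_
        rintro ⟨f', g'⟩ ⟨h1, h2⟩
        have h3 : g' x ≤ g x := by
          by_contra! h
          have h4 : g' x < f.symm a := h2
          exact absurd (hc _ h) (not_le.2 (by rwa [OrderIso.lt_symm_apply] at h4))
        exact lt_of_le_of_lt (f'.monotone h3) (show f' (g x) < a from h1)
  have hinv : Continuous fun g : X ≃o X => g⁻¹ := by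
    refine continuous_autPointwise_iff.2 fun x => continuous_generateFrom_iff.2 ?_
    rintro s ⟨a, rfl | rfl⟩
    · convert hlt a x using 1
      ext g
      exact OrderIso.lt_symm_apply g
    · convert hgt a x using 1
      ext g
      exact OrderIso.symm_apply_lt g
  exact { continuous_mul := hmul, continuous_inv := hinv }

/-- The permutation topology `τ_∂` on `Aut(X)`: pointwise convergence, where `X` is discrete. -/
def permTopology (X : Type*) [LinearOrder X] : GroupTopology (X ≃o X) :=
  { autPointwise X ⊥, isTopologicalGroup_autPointwise_bot X with }

/-- The topology `τ_p` on `Aut(X)`: pointwise convergence, where `X` carries the topology of the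
linear order. -/
def pointwiseTopology (X : Type*) [LinearOrder X] : GroupTopology (X ≃o X) :=
  { autPointwise X (Preorder.topology X), isTopologicalGroup_autPointwise_order X with }

/-- A group topology on `Aut(X)` is admissible for the action on `(X, σ)` if the action
`Aut(X) × X → X` is (jointly) continuous. -/
def IsAdmissible {X : Type*} [LinearOrder X] (σ : TopologicalSpace X)
    (τ : GroupTopology (X ≃o X)) : Prop :=
  letI := τ.toTopologicalSpace
  Continuous fun p : (X ≃o X) × X => p.1 p.2

/-! ### Homogeneous GO-spaces -/

/-- `(X, σ)` is a generalized ordered space: `σ` refines the topology of the linear order and has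
a base consisting of (order-convex) intervals. -/
def IsGOTopology {X : Type*} [LinearOrder X] (σ : TopologicalSpace X) : Prop :=
  σ ≤ Preorder.topology X ∧
    ∃ B : Set (Set X), (∀ s ∈ B, s.OrdConnected) ∧ @TopologicalSpace.IsTopologicalBasis X σ B

/-- For a homogeneous chain `X`: `(X, σ)` is a homogeneous GO-space on `X`, i.e. a GO-space on
which (the transitive group) `Aut(X)` acts by homeomorphisms. As the inverse of an automorphism is
an automorphism, it is enough to ask for continuity. -/
def IsHomogeneousGOTopology {X : Type*} [LinearOrder X] (σ : TopologicalSpace X) : Prop :=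
  IsGOTopology σ ∧ ∀ g : X ≃o X, @Continuous X X σ σ g

/-! ### Homogeneous, simple, rigid and ultrahomogeneous chains -/

/-- `Aut(X)` acts transitively on `X`. -/
def IsHomogeneousChain (X : Type*) [LinearOrder X] : Prop :=
  ∀ x y : X, ∃ g : X ≃o X, g x = y

/-- A non-empty interval (order-convex subset) `J` is regular if an automorphism that maps some
point of `J` into `J` maps all of `J` into `J`. -/
def IsRegularInterval {X : Type*} [LinearOrder X] (J : Set X) : Prop :=
  J.Nonempty ∧ J.OrdConnected ∧ ∀ x ∈ J, ∀ y ∈ J, ∀ g : X ≃o X, g x ∈ J → g y ∈ J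

/-- A simple chain: a homogeneous chain whose only regular intervals are the points and `X`. -/
def IsSimpleChain (X : Type*) [LinearOrder X] : Prop :=
  IsHomogeneousChain X ∧
    ∀ J : Set X, IsRegularInterval J → (∃ x, J = {x}) ∨ J = univ

/-- A rigid (homogeneous) chain: `Aut(X)` is uniquely transitive on `X`. -/
def IsRigidChain (X : Type*) [LinearOrder X] : Prop :=
  ∀ x y : X, ∃! g : X ≃o X, g x = y

/-- An ultrahomogeneous chain: any `x₁ < ⋯ < xₙ` can be mapped to any `y₁ < ⋯ < yₙ` by an
automorphism. -/
def IsUltrahomogeneousChain (X : Type*) [LinearOrder X] : Prop :=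
  ∀ (n : ℕ) (x y : Fin n → X), StrictMono x → StrictMono y →
    ∃ g : X ≃o X, ∀ k, g (x k) = y k

/-!
The theorem rests on the dichotomy that a simple chain `X` is rigid or ultrahomogeneous
(`IsSimpleChain.isUltrahomogeneousChain`); a chain with more than one point cannot be both.

*Dichotomy.* `Aut(X)` is closed under pointwise maxima (`autSup`), and under pasting two
automorphisms along a cut at which they agree (`autPaste`). For `x < t` let `E` be the lower set of
the points `w` with `g x ≤ x` and `w ≤ g t` for some automorphism `g`. If `E = X` for all `x < t`,
then maxima and minima with suitable automorphisms yield 2-homogeneity, and pasting yields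
ultrahomogeneity. Suppose `E ≠ X`. An automorphism that does not move `x` upwards does not move the
cut `E` upwards, so `x` and `t` control `E`; simplicity implies that all points of `E` control it
(`IsSimpleChain.controls_of_mem`). If `X` were not rigid, pasting would yield a non-trivial
automorphism `b` that is the identity below a fixed point `x₀`
(`exists_fixed_lt_moved_of_not_isRigidChain`). Each translate of `E` is either controlled by `x₀` or
contained in the part where `b` is the identity, so `b` fixes all translates of `E`. Their common
stabilizer is then a non-trivial normal subgroup whose orbits are bounded above, and the
convex hulls of these orbits are regular intervals; this contradicts simplicity (`IsSimpleChain.exists_le_and_le`).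

*Rigid chains.* Here `Aut(X)` is linearly ordered pointwise, and the unit has a neighbourhood
`{g | g x < y}` which is bounded above, in every topology for which `g ↦ g x` is continuous into the
order topology. Finitely many of its two-sided translates are bounded above, while `Aut(X)` is
not; so `Aut(X)` is not Roelcke precompact (`IsRigidChain.not_isRoelckePrecompact`).

*Ultrahomogeneous chains.* For finite `F ⊆ X` the double coset of `g` with respect to the pointwise
stabilizer of `F` depends only on the relative position of `g F` and `F`, for which there are
finitely many possibilities. So the permutation topology is Roelcke precompact
(`IsUltrahomogeneousChain.isRoelckePrecompact_permTopology`). It is admissible for every homogeneous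
GO-space (`isAdmissible_permTopology`), and `τ_p` is coarser, so `τ_p` is Roelcke precompact too.
-/

section

open scoped Pointwise

variable {X : Type*} [LinearOrder X]

/-! ### Lattice operations and pasting of automorphisms -/

/-- The pointwise maximum of two automorphisms of a chain. -/
noncomputable def autSup (g h : X ≃o X) : X ≃o X :=
  StrictMono.orderIsoOfSurjective (fun x => max (g x) (h x))
    (fun _ _ hxy => max_lt_max (g.strictMono hxy) (h.strictMono hxy)) <| by
      intro y
      rcases le_total (g.symm y) (h.symm y) with hle | hle
      · refine ⟨g.symm y, ?_⟩
        have : h (g.symm y) ≤ y := by simpa using h.monotone hle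
        simpa using this
      · refine ⟨h.symm y, ?_⟩
        have : g (h.symm y) ≤ y := by simpa using g.monotone hle
        simpa using this

theorem autSup_apply (g h : X ≃o X) (x : X) : autSup g h x = max (g x) (h x) := rfl

open Classical in
/-- The automorphism that agrees with `g` on the lower set `D` and with `h` off `D`, where `g` and
`h` map `D` onto the same set. -/
noncomputable def autPaste (D : Set X) (hD : IsLowerSet D) (g h : X ≃o X) (hgh : g • D = h • D) :
    X ≃o X :=
  StrictMono.orderIsoOfSurjective (fun x => if x ∈ D then g x else h x)
    (by
      intro x y hxy
      by_cases hx : x ∈ D <;> by_cases hy : y ∈ D <;> simp only [hx, hy, if_true, if_false]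
      · exact g.strictMono hxy
      · have h1 : g x ∈ h • D := hgh ▸ ⟨x, hx, rfl⟩
        obtain ⟨z, hz, hzx⟩ := h1
        have hzx : h z = g x := hzx
        rw [← hzx]
        exact h.strictMono (lt_of_not_ge fun hle => hy (hD hle hz))
      · exact absurd (hD hxy.le hy) hx
      · exact h.strictMono hxy)
    (by
      intro y
      by_cases hy : y ∈ g • D
      · obtain ⟨z, hz, hzy⟩ := hy
        exact ⟨z, by simpa [hz] using hzy⟩
      · have hz : h.symm y ∉ D := fun hz => hy (hgh ▸ ⟨_, hz, h.apply_symm_apply y⟩)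
        exact ⟨h.symm y, by simp [hz]⟩)

theorem autPaste_of_mem {D : Set X} (hD : IsLowerSet D) {g h : X ≃o X} (hgh : g • D = h • D)
    {x : X} (hx : x ∈ D) : autPaste D hD g h hgh x = g x := if_pos hx

theorem autPaste_of_notMem {D : Set X} (hD : IsLowerSet D) {g h : X ≃o X} (hgh : g • D = h • D)
    {x : X} (hx : x ∉ D) : autPaste D hD g h hgh x = h x := if_neg hx

theorem IsLowerSet.aut_smul {D : Set X} (hD : IsLowerSet D) (g : X ≃o X) :
    IsLowerSet (g • D) := by
  rintro _ y hy ⟨z, hz, rfl⟩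
  refine ⟨g⁻¹ y, hD ?_ hz, RelIso.apply_inv_self g y⟩
  have := (g⁻¹).monotone hy
  rwa [show (g⁻¹ : X ≃o X) ((fun x => g • x) z) = z from RelIso.inv_apply_self g z] at this

theorem aut_mem_smul_iff {D : Set X} {g : X ≃o X} {x : X} : g x ∈ g • D ↔ x ∈ D :=
  Set.smul_mem_smul_set_iff

theorem aut_smul_Iic (g : X ≃o X) (x : X) : g • Iic x = Iic (g x) := g.image_Iic x

theorem aut_smul_Iic_subset_iff {g : X ≃o X} {x : X} : g • Iic x ⊆ Iic x ↔ g x ≤ x := by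
  rw [aut_smul_Iic, Iic_subset_Iic]

theorem autSup_one_smul {D : Set X} (hD : IsLowerSet D) {g : X ≃o X} (hg : g • D ⊆ D) :
    autSup 1 g • D = D := by
  refine Subset.antisymm ?_ ?_
  · rintro _ ⟨z, hz, rfl⟩
    change max z (g z) ∈ D
    rcases max_choice z (g z) with h | h <;> rw [h]
    exacts [hz, hg ⟨z, hz, rfl⟩]
  · intro w hw
    refine ⟨(autSup 1 g).symm w, hD ?_ hw, (autSup 1 g).apply_symm_apply w⟩
    rw [OrderIso.symm_apply_le]
    exact le_max_left _ _

/-! ### Cuts controlled by cuts -/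

/-- The lower set `D` controls `E` if each automorphism that does not move the cut `D` upwards
does not move the cut `E` upwards either. -/
def Controls (D E : Set X) : Prop := ∀ g : X ≃o X, g • D ⊆ D → g • E ⊆ E

theorem Controls.smul {D E : Set X} (h : Controls D E) (k : X ≃o X) :
    Controls (k • D) (k • E) := by
  intro g hg
  have h1 := h (k⁻¹ * g * k) (by rwa [mul_smul, mul_smul, ← Set.subset_smul_set_iff])
  rwa [mul_smul, mul_smul, ← Set.subset_smul_set_iff] at h1

/-- An automorphism that fixes `D'` can be replaced by the identity below `D'`, so that a cut `D'`
between `D` and `E` inherits the control over `E` from `D`. -/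
theorem Controls.of_subset {D D' E : Set X} (hD' : IsLowerSet D') (hE : IsLowerSet E)
    (h1 : D ⊆ D') (h2 : D' ⊆ E) (h : Controls D E) : Controls D' E := by
  rintro g hg _ ⟨z, hz, rfl⟩
  by_contra hgz
  replace hgz : g z ∉ E := hgz
  have hzD : z ∉ D' := fun hzD => hgz (h2 (hg ⟨z, hzD, rfl⟩))
  have hp : (1 : X ≃o X) • D' = autSup 1 g • D' := by rw [one_smul, autSup_one_smul hD' hg]
  have h3 : autPaste D' hD' 1 (autSup 1 g) hp • E ⊆ E := by
    refine h _ ?_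
    rintro _ ⟨y, hy, rfl⟩
    change autPaste D' hD' 1 (autSup 1 g) hp y ∈ D
    rwa [autPaste_of_mem hD' hp (h1 hy)]
  have h4 : autPaste D' hD' 1 (autSup 1 g) hp z ∈ E := h3 ⟨z, hz, rfl⟩
  rw [autPaste_of_notMem hD' hp hzD] at h4
  exact hgz (hE (le_max_right _ _) h4)

/-- The points below the cut `E` that control it. They form a final segment of `E`. -/
def controllers (E : Set X) : Set X := {x | x ∈ E ∧ Controls (Iic x) E}

theorem controllers_of_le {E : Set X} (hE : IsLowerSet E) {x y : X} (hx : x ∈ controllers E)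
    (hxy : x ≤ y) (hy : y ∈ E) : y ∈ controllers E :=
  ⟨hy, hx.2.of_subset (isLowerSet_Iic y) hE (Iic_subset_Iic.2 hxy) (hE.Iic_subset hy)⟩

theorem aut_mem_controllers {E : Set X} {x : X} (hx : x ∈ controllers E) (g : X ≃o X) :
    g x ∈ controllers (g • E) :=
  ⟨aut_mem_smul_iff.2 hx.1, aut_smul_Iic g x ▸ hx.2.smul g⟩

theorem controllers_subset_of_subset {E F : Set X} (hE : IsLowerSet E) (hF : IsLowerSet F)
    (hEF : E ⊆ F) {z : X} (hz : z ∈ controllers E) (hz' : z ∈ controllers F) :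
    controllers E ⊆ controllers F := by
  have h : Controls E F := hz'.2.of_subset hE hF (hE.Iic_subset hz.1) hEF
  exact fun x hx => ⟨hEF hx.1, fun g hg => h g (hx.2 g hg)⟩

theorem controllers_subset_total {E F : Set X} (hE : IsLowerSet E) (hF : IsLowerSet F)
    {z : X} (hz : z ∈ controllers E) (hz' : z ∈ controllers F) :
    controllers E ⊆ controllers F ∨ controllers F ⊆ controllers E :=
  (hE.total hF).imp (fun h => controllers_subset_of_subset hE hF h hz hz')
    fun h => controllers_subset_of_subset hF hE h hz' hz

/-- Translates of `E` with a common controlling point have the same non-controlling points. If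
`E ⊆ g • E` differ and `y ∈ E` controls `g • E`, then `g⁻¹ y` controls `E`, and `g⁻¹ y < y` because
`g` moves `E` upwards; so `y` controls `E`. -/
theorem diff_controllers_eq_of_subset {E : Set X} (hE : IsLowerSet E) {g : X ≃o X}
    (hEg : E ⊆ g • E) {z : X} (hz : z ∈ controllers E) (hz' : z ∈ controllers (g • E)) :
    E \ controllers E = (g • E) \ controllers (g • E) := by
  have hF := hE.aut_smul g
  have hsub := controllers_subset_of_subset hE hF hEg hz hz'
  have hback : ∀ y ∈ E, y ∈ controllers (g • E) → y ∈ controllers E := by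
    intro y hy hyF
    have hx : g⁻¹ y ∈ controllers E := by simpa using aut_mem_controllers hyF g⁻¹
    rcases le_total y (g⁻¹ y) with hle | hle
    · have h1 : g • E ⊆ E := hx.2 g (aut_smul_Iic_subset_iff.2 (by simpa using hle))
      rwa [← Subset.antisymm hEg h1] at hyF
    · exact controllers_of_le hE hx hle hy
  ext y
  constructor
  · exact fun hy => ⟨hEg hy.1, fun hyF => hy.2 (hback y hy.1 hyF)⟩
  · rintro ⟨hy, hyF⟩
    have hyz : y ≤ z := le_of_not_ge fun hle => hyF (controllers_of_le hF hz' hle hy)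
    exact ⟨hE hyz hz.1, fun h => hyF (hsub h)⟩

theorem diff_controllers_eq {E : Set X} (hE : IsLowerSet E) {g : X ≃o X} {z : X}
    (hz : z ∈ controllers E) (hz' : z ∈ controllers (g • E)) :
    E \ controllers E = (g • E) \ controllers (g • E) := by
  rcases hE.total (hE.aut_smul g) with h | h
  · exact diff_controllers_eq_of_subset hE h hz hz'
  · have := diff_controllers_eq_of_subset (hE.aut_smul g) (g := g⁻¹) (by simpa using h) hz'
      (by simpa using hz)
    simpa using this.symm

/-- In a simple chain, a cut that is controlled by two points is controlled by all points below
it. The points which control a translate of `E` together with `x` form a regular interval, hence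
all of `X`; then all translates of `E` have the same set of non-controlling points below them, and
this invariant set is empty by transitivity. -/
theorem IsSimpleChain.controls_of_mem (hX : IsSimpleChain X) {E : Set X} (hE : IsLowerSet E)
    {x t : X} (hxt : x ≠ t) (hx : x ∈ controllers E) (ht : t ∈ controllers E) {y : X}
    (hy : y ∈ E) : Controls (Iic y) E := by
  let J : Set X := {y | ∃ h : X ≃o X, y ∈ controllers (h • E) ∧ x ∈ controllers (h • E)}
  have hlow : ∀ h : X ≃o X, IsLowerSet (h • E) := fun h => hE.aut_smul h
  have hxJ : x ∈ J := ⟨1, by simpa using hx, by simpa using hx⟩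
  have htJ : t ∈ J := ⟨1, by simpa using ht, by simpa using hx⟩
  have hcommon : ∀ y ∈ J, ∀ z ∈ J, ∃ h : X ≃o X,
      y ∈ controllers (h • E) ∧ z ∈ controllers (h • E) ∧ x ∈ controllers (h • E) := by
    rintro y ⟨h, hy, hxh⟩ z ⟨k, hz, hxk⟩
    rcases controllers_subset_total (hlow h) (hlow k) hxh hxk with hs | hs
    exacts [⟨k, hs hy, hz, hxk⟩, ⟨h, hy, hs hz, hxh⟩]
  have hJ : IsRegularInterval J := by
    refine ⟨⟨x, hxJ⟩, ⟨?_⟩, ?_⟩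
    · intro y hy z hz w hw
      obtain ⟨h, h1, h2, h3⟩ := hcommon y hy z hz
      exact ⟨h, controllers_of_le (hlow h) h1 hw.1 (hlow h hw.2 h2.1), h3⟩
    · rintro y hy z hz g ⟨k, hk1, hk2⟩
      obtain ⟨h, h1, h2, -⟩ := hcommon y hy z hz
      have h1' := aut_mem_controllers h1 g
      have h2' := aut_mem_controllers h2 g
      rw [← mul_smul] at h1' h2'
      rcases controllers_subset_total (hlow (g * h)) (hlow k) h1' hk1 with hs | hs
      exacts [⟨k, hs h2', hk2⟩, ⟨g * h, h2', hs hk2⟩]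
  rcases hX.2 J hJ with ⟨p, hp⟩ | hJuniv
  · rw [hp] at hxJ htJ
    exact absurd (hxJ.trans htJ.symm) hxt
  · have hconst : ∀ h : X ≃o X, E \ controllers E = (h • E) \ controllers (h • E) := by
      intro h
      obtain ⟨k, hk1, hk2⟩ : h x ∈ J := hJuniv ▸ mem_univ _
      have h1 := aut_mem_controllers hx h
      have h2 := diff_controllers_eq (hlow h) (g := k * h⁻¹) h1 (by simpa [← mul_smul] using hk1)
      have h3 := diff_controllers_eq hE hx hk2
      rw [h3, h2, ← mul_smul, inv_mul_cancel_right]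
    by_contra hcon
    obtain ⟨h, hh⟩ := hX.1 y x
    have hmem : x ∈ (h • E) \ controllers (h • E) := by
      refine ⟨hh ▸ aut_mem_smul_iff.2 hy, fun hc => hcon ?_⟩
      have := aut_mem_controllers hc h⁻¹
      rw [← hh, inv_smul_smul, RelIso.inv_apply_self] at this
      exact this.2
    rw [← hconst h] at hmem
    exact hmem.2 hx

/-! ### A simple chain is rigid or ultrahomogeneous -/

theorem exists_fixed_ne_of_not_isRigidChain (hX : IsHomogeneousChain X) (h : ¬ IsRigidChain X) :
    ∃ (a : X ≃o X) (x t : X), a x = x ∧ a t ≠ t := by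
  by_contra! hcon
  refine h fun x y => ?_
  obtain ⟨g, hg⟩ := hX x y
  refine ⟨g, hg, fun k hk => ?_⟩
  ext t
  have h1 := hcon (g⁻¹ * k) x t (by
    change g⁻¹ (k x) = x
    rw [hk, ← hg, RelIso.inv_apply_self])
  rw [← RelIso.apply_inv_self g (k t)]
  exact congrArg g h1

/-- If a non-trivial automorphism `a` of a homogeneous chain has a fixed point, then some such
automorphism moves a point above its fixed point. Otherwise `a` moves some `t₀` below its fixed
point `x₀` downwards, say, and an automorphism `k` with `k x₀ = t₀` maps `t₀` below all
`aⁿ t₀`. The cut below all `aⁿ t₀` is then non-empty, and `a` can be replaced by the identity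
below it. -/
theorem exists_fixed_lt_moved_of_not_isRigidChain (hX : IsHomogeneousChain X)
    (h : ¬ IsRigidChain X) :
    ∃ (a : X ≃o X) (x t : X), x < t ∧ a x = x ∧ a t ≠ t := by
  by_contra! hcon
  obtain ⟨a, x₀, t₀, hax, hat⟩ : ∃ (a : X ≃o X) (x t : X), a x = x ∧ a t < t := by
    obtain ⟨a, x, t, hax, hat⟩ := exists_fixed_ne_of_not_isRigidChain hX h
    rcases lt_or_gt_of_ne hat with hlt | hlt
    · exact ⟨a, x, t, hax, hlt⟩
    · refine ⟨a⁻¹, x, t, ?_, ?_⟩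
      · rw [← hax, RelIso.inv_apply_self, hax]
      · exact (OrderIso.symm_apply_lt a).2 hlt
  have htx : t₀ < x₀ := by
    rcases lt_trichotomy t₀ x₀ with hlt | heq | hlt
    · exact hlt
    · rw [heq, hax] at hat
      exact absurd hat (lt_irrefl _)
    · exact absurd (hcon a x₀ t₀ hlt hax) hat.ne
  have hfix : ∀ n : ℕ, (a ^ n) x₀ = x₀ := by
    intro n
    induction n with
    | zero => rfl
    | succ n ih =>
      rw [pow_succ]
      change (a ^ n) (a x₀) = x₀
      rw [hax, ih]
  have hstep : ∀ n : ℕ, (a ^ (n + 1)) t₀ < (a ^ n) t₀ := fun n => by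
    rw [pow_succ]
    exact (a ^ n).strictMono hat
  obtain ⟨k, hk⟩ := hX x₀ t₀
  have hkt : ∀ n : ℕ, k t₀ < (a ^ n) t₀ := by
    intro n
    by_contra! hle
    let f : X ≃o X := k⁻¹ * a ^ n
    have hft : f t₀ ≤ t₀ := by
      have := (k⁻¹).monotone hle
      rwa [RelIso.inv_apply_self] at this
    have hfx : x₀ < f x₀ := by
      change x₀ < k⁻¹ ((a ^ n) x₀)
      rw [hfix]
      have := (k⁻¹).strictMono htx
      rwa [← hk, RelIso.inv_apply_self] at this
    have h1 := hcon (autSup 1 f) t₀ x₀ htx (max_eq_left hft)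
    have h2 : f x₀ ≤ autSup 1 f x₀ := le_max_right _ _
    rw [h1] at h2
    exact absurd hfx (not_lt.2 h2)
  let D : Set X := {z | ∀ n : ℕ, z < (a ^ n) t₀}
  have hD : IsLowerSet D := fun x y hyx hx n => hyx.trans_lt (hx n)
  have haD : (1 : X ≃o X) • D = a • D := by
    rw [one_smul]
    refine Subset.antisymm ?_ ?_
    · intro z hz
      refine ⟨a⁻¹ z, fun n => ?_, RelIso.apply_inv_self a z⟩
      refine (OrderIso.symm_apply_lt a).2 ?_
      have := hz (n + 1)
      rwa [pow_succ'] at this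
    · rintro _ ⟨z, hz, rfl⟩ n
      refine lt_trans ?_ (hstep n)
      rw [pow_succ']
      exact a.strictMono (hz n)
  have hkD : k t₀ ∈ D := hkt
  have htD : t₀ ∉ D := fun hmem => lt_irrefl _ (hmem 0)
  have h1 := hcon (autPaste D hD 1 a haD) (k t₀) t₀ (hkt 0) (autPaste_of_mem hD haD hkD)
  rw [autPaste_of_notMem hD haD htD] at h1
  exact hat.ne h1

/-- The convex hull of an orbit of a normal subgroup of `Aut(X)` is a regular interval. -/
theorem isRegularInterval_hull_orbit (K : Subgroup (X ≃o X)) [K.Normal] (t : X) :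
    IsRegularInterval {y : X | ∃ k₁ ∈ K, ∃ k₂ ∈ K, k₁ t ≤ y ∧ y ≤ k₂ t} := by
  refine ⟨⟨t, 1, K.one_mem, 1, K.one_mem, le_rfl, le_rfl⟩, ⟨?_⟩, ?_⟩
  · rintro y ⟨k₁, h₁, -, -, hy, -⟩ z ⟨-, -, k₂, h₂, -, hz⟩ w hw
    exact ⟨k₁, h₁, k₂, h₂, hy.trans hw.1, hw.2.trans hz⟩
  · have key : ∀ g k l : X ≃o X, ∀ y z : X, k t ≤ y → z ≤ l t →
        g z ≤ (g * (l * k⁻¹) * g⁻¹) (g y) := by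
      intro g k l y z hy hz
      change g z ≤ g (l (k⁻¹ (g⁻¹ (g y))))
      rw [RelIso.inv_apply_self]
      refine g.monotone (hz.trans (l.monotone ?_))
      have := (k⁻¹).monotone hy
      rwa [RelIso.inv_apply_self] at this
    have conj : ∀ g k l : X ≃o X, k ∈ K → l ∈ K → g * (l * k⁻¹) * g⁻¹ ∈ K := fun g k l hk hl =>
      Subgroup.Normal.conj_mem inferInstance _ (K.mul_mem hl (K.inv_mem hk)) g
    rintro y ⟨k₁, h₁, k₂, h₂, hy₁, hy₂⟩ z ⟨l₁, m₁, l₂, m₂, hz₁, hz₂⟩ g ⟨p, hp, q, hq, hp', hq'⟩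
    refine ⟨(g * (k₂ * l₁⁻¹) * g⁻¹)⁻¹ * p, K.mul_mem (K.inv_mem (conj g _ _ m₁ h₂)) hp,
      (g * (l₂ * k₁⁻¹) * g⁻¹) * q, K.mul_mem (conj g _ _ h₁ m₂) hq, ?_, ?_⟩
    · have h3 := hp'.trans (key g l₁ k₂ z y hz₁ hy₂)
      have h4 := ((g * (k₂ * l₁⁻¹) * g⁻¹)⁻¹).monotone h3
      rwa [RelIso.inv_apply_self] at h4
    · exact (key g k₁ l₂ y z hy₁ hz₂).trans ((g * (l₂ * k₁⁻¹) * g⁻¹).monotone hq')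

/-- The common stabilizer of all translates of a cut `E`. -/
def cutOrbitFixer (E : Set X) : Subgroup (X ≃o X) where
  carrier := {k | ∀ h : X ≃o X, k • h • E = h • E}
  one_mem' h := one_smul _ _
  mul_mem' {k l} hk hl h := by rw [mul_smul, hl h, hk h]
  inv_mem' {k} hk h := by rw [inv_smul_eq_iff, hk h]

instance cutOrbitFixer_normal (E : Set X) : (cutOrbitFixer E).Normal where
  conj_mem k hk g h := by
    have h1 := hk (g⁻¹ * h)
    rw [mul_smul, mul_smul, ← mul_smul g⁻¹ h E, h1, mul_smul, smul_inv_smul]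

/-- In a simple chain that is not rigid, the stabilizer of `x` moves each `t > x` beyond every
bound. The points which `t` can reach form a cut `E` that is controlled by all points of its
translates. If `E` is a proper subset, then a non-trivial automorphism that is the identity below a
point fixes all translates of `E`; so their common stabilizer is a non-trivial normal
subgroup, all of whose orbits are bounded above, contrary to simplicity. -/
theorem IsSimpleChain.exists_le_and_le (hX : IsSimpleChain X) (hr : ¬ IsRigidChain X) {x t : X}
    (hxt : x < t) (w : X) : ∃ g : X ≃o X, g x ≤ x ∧ w ≤ g t := by
  by_contra hw
  let E : Set X := {w | ∃ g : X ≃o X, g x ≤ x ∧ w ≤ g t}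
  have hE : IsLowerSet E := fun a b hba ⟨g, h1, h2⟩ => ⟨g, h1, hba.trans h2⟩
  have htE : t ∈ E := ⟨1, le_rfl, le_rfl⟩
  have hxE : x ∈ E := hE hxt.le htE
  have hxc : x ∈ controllers E := by
    refine ⟨hxE, fun g hg => ?_⟩
    rw [aut_smul_Iic_subset_iff] at hg
    rintro _ ⟨z, ⟨k, hk, hz⟩, rfl⟩
    exact ⟨g * k, (g.monotone hk).trans hg, g.monotone hz⟩
  have htc : t ∈ controllers E := controllers_of_le hE hxc hxt.le htE
  have hall : ∀ y ∈ E, Controls (Iic y) E := fun y hy =>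
    hX.controls_of_mem hE hxt.ne hxc htc hy
  obtain ⟨a, x₀, t₀, hlt, hax, hat⟩ := exists_fixed_lt_moved_of_not_isRigidChain hX.1 hr
  have hD : (1 : X ≃o X) • Iic x₀ = a • Iic x₀ := by rw [one_smul, aut_smul_Iic, hax]
  let b := autPaste (Iic x₀) (isLowerSet_Iic x₀) 1 a hD
  have hb : ∀ z ≤ x₀, b z = z := fun z hz => autPaste_of_mem _ hD hz
  have hbt : b t₀ ≠ t₀ := by
    rw [show b t₀ = a t₀ from autPaste_of_notMem _ hD (not_le.2 hlt)]
    exact hat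
  have hbK : b ∈ cutOrbitFixer E := by
    intro h
    by_cases hx₀ : x₀ ∈ h • E
    · have hc : Controls (Iic x₀) (h • E) := by
        have h1 : h⁻¹ x₀ ∈ E := Set.mem_smul_set_iff_inv_smul_mem.1 hx₀
        have h2 := (hall _ h1).smul h
        rwa [aut_smul_Iic, RelIso.apply_inv_self] at h2
      refine Subset.antisymm (hc b (aut_smul_Iic_subset_iff.2 (hb x₀ le_rfl).le)) ?_
      rw [Set.subset_smul_set_iff]
      refine hc b⁻¹ (aut_smul_Iic_subset_iff.2 ?_)
      nth_rewrite 1 [← hb x₀ le_rfl]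
      rw [RelIso.inv_apply_self]
    · have hle : ∀ z ∈ h • E, z ≤ x₀ := fun z hz =>
        le_of_not_ge fun hge => hx₀ (hE.aut_smul h hge hz)
      have h1 : ∀ z ∈ h • E, b • z = z := fun z hz => hb z (hle z hz)
      exact (image_congr h1).trans (image_id _)
  rcases hX.2 _ (isRegularInterval_hull_orbit (cutOrbitFixer E) t₀) with ⟨p, hp⟩ | hu
  · have h1 : t₀ ∈ ({p} : Set X) := hp ▸ ⟨1, one_mem _, 1, one_mem _, le_rfl, le_rfl⟩
    have h2 : b t₀ ∈ ({p} : Set X) := hp ▸ ⟨b, hbK, b, hbK, le_rfl, le_rfl⟩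
    exact hbt (h2.trans h1.symm)
  · obtain ⟨h, hh⟩ := hX.1 t t₀
    have h1 : t₀ ∈ h • E := hh ▸ aut_mem_smul_iff.2 htE
    have h2 : h w ∉ h • E := fun hm => hw (show w ∈ E from aut_mem_smul_iff.1 hm)
    obtain ⟨-, -, k, hk, -, hle⟩ := hu.symm ▸ mem_univ (h w)
    refine h2 (hE.aut_smul h hle ?_)
    rw [← hk h]
    exact aut_mem_smul_iff.2 h1

theorem IsSimpleChain.exists_fixed_map_eq (hX : IsSimpleChain X) (hr : ¬ IsRigidChain X)
    {x t w : X} (hxt : x < t) (hxw : x < w) : ∃ g : X ≃o X, g x = x ∧ g t = w := by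
  have key : ∀ t w : X, x < t → t ≤ w → ∃ g : X ≃o X, g x = x ∧ g t = w := by
    intro t w hxt htw
    obtain ⟨g, hgx, hgt⟩ := hX.exists_le_and_le hr hxt w
    obtain ⟨k, hk⟩ := hX.1 t w
    -- the automorphism `(k ⊓ g) ⊔ 1`
    refine ⟨autSup 1 (autSup k⁻¹ g⁻¹)⁻¹, max_eq_left ?_, ?_⟩
    · refine (OrderIso.symm_apply_le _).2 ((le_max_right _ _).trans' ?_)
      exact (OrderIso.le_symm_apply g).2 hgx
    · have h1 : (autSup k⁻¹ g⁻¹)⁻¹ t = w := by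
        refine (OrderIso.symm_apply_eq _).2 ?_
        have h2 : k⁻¹ w = t := by rw [← hk, RelIso.inv_apply_self]
        have h3 : g⁻¹ w ≤ t := (OrderIso.symm_apply_le g).2 hgt
        rw [autSup_apply, h2, max_eq_left h3]
      change max t ((autSup k⁻¹ g⁻¹)⁻¹ t) = w
      rw [h1, max_eq_right htw]
  rcases le_total t w with h | h
  · exact key t w hxt h
  · obtain ⟨g, h1, h2⟩ := key w t hxw h
    refine ⟨g⁻¹, ?_, ?_⟩
    · rw [← h1, RelIso.inv_apply_self, h1]
    · rw [← h2, RelIso.inv_apply_self]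

theorem isUltrahomogeneousChain_of_two (h1 : IsHomogeneousChain X)
    (h2 : ∀ x t y w : X, x < t → y < w → ∃ g : X ≃o X, g x = y ∧ g t = w) :
    IsUltrahomogeneousChain X := by
  intro n
  induction n with
  | zero => exact fun x y _ _ => ⟨1, fun k => k.elim0⟩
  | succ n ih =>
    intro x y hx hy
    cases n with
    | zero =>
      obtain ⟨g, hg⟩ := h1 (x 0) (y 0)
      exact ⟨g, fun k => by rwa [Subsingleton.elim (α := Fin 1) k 0]⟩
    | succ n =>
      obtain ⟨g, hg⟩ := ih (fun k => x k.castSucc) (fun k => y k.castSucc)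
        (hx.comp (Fin.strictMono_castSucc)) (hy.comp (Fin.strictMono_castSucc))
      have hlast : (Fin.last n).castSucc < Fin.last (n + 1) := Fin.castSucc_lt_last _
      obtain ⟨k, hk1, hk2⟩ := h2 _ _ _ _ (hx hlast) (hy hlast)
      have hD : g • Iic (x (Fin.last n).castSucc) = k • Iic (x (Fin.last n).castSucc) := by
        rw [aut_smul_Iic, aut_smul_Iic, hk1, hg]
      refine ⟨autPaste _ (isLowerSet_Iic _) g k hD, fun i => ?_⟩
      induction i using Fin.lastCases with
      | last => rw [autPaste_of_notMem _ hD (not_le.2 (hx hlast)), hk2]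
      | cast i =>
        rw [autPaste_of_mem _ hD (hx.monotone (Fin.castSucc_le_castSucc_iff.2 (Fin.le_last i)))]
        exact hg i

theorem IsSimpleChain.isUltrahomogeneousChain (hX : IsSimpleChain X) (hr : ¬ IsRigidChain X) :
    IsUltrahomogeneousChain X := by
  refine isUltrahomogeneousChain_of_two hX.1 fun x t y w hxt hyw => ?_
  obtain ⟨k, hk⟩ := hX.1 x y
  obtain ⟨g, hg1, hg2⟩ := hX.exists_fixed_map_eq hr (hk ▸ k.strictMono hxt) hyw
  exact ⟨g * k, (congrArg g hk).trans hg1, hg2⟩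

/-! ### Roelcke precompactness by double cosets -/

theorem GroupTopology.isRoelckePrecompact_iff {G : Type*} [Group G] (τ : GroupTopology G) :
    τ.IsRoelckePrecompact ↔ ∀ V ∈ @nhds G τ.toTopologicalSpace 1,
      ∃ t : Set G, t.Finite ∧ ∀ x, ∃ y ∈ t, ∃ a ∈ V, ∃ b ∈ V, y = a * x * b := by
  let := τ.toTopologicalSpace
  have := τ.toIsTopologicalGroup
  have hb := hasBasis_roelcke G
  constructor
  · intro h V hV
    obtain ⟨t, ht, hs⟩ := h _ (hb.mem_of_mem hV)
    exact ⟨t, ht, fun x => by simpa using hs (mem_univ x)⟩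
  · intro h d hd
    obtain ⟨V, hV, hVd⟩ := hb.mem_iff.1 hd
    obtain ⟨t, ht, hs⟩ := h V hV
    refine ⟨t, ht, fun x _ => ?_⟩
    obtain ⟨y, hy, hxy⟩ := hs x
    exact mem_iUnion₂.2 ⟨y, hy, hVd hxy⟩

theorem GroupTopology.IsRoelckePrecompact.mono {G : Type*} [Group G] {τ τ' : GroupTopology G}
    (h : τ.IsRoelckePrecompact) (hle : τ.toTopologicalSpace ≤ τ'.toTopologicalSpace) :
    τ'.IsRoelckePrecompact := by
  rw [GroupTopology.isRoelckePrecompact_iff] at h ⊢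
  exact fun V hV => h V (nhds_mono hle hV)

/-! ### Rigid chains are not Roelcke precompact -/

/-- The automorphisms of a rigid chain are linearly ordered pointwise. -/
theorem IsRigidChain.le_of_apply_le (hr : IsRigidChain X) {g h : X ≃o X} {x : X}
    (hx : g x ≤ h x) (y : X) : g y ≤ h y := by
  have h1 : autSup g h = h := (hr x (h x)).unique (max_eq_right hx) rfl
  rw [← max_eq_right_iff, ← autSup_apply, h1]

theorem IsHomogeneousChain.exists_gt [Nontrivial X] (hX : IsHomogeneousChain X) (x : X) :
    ∃ y, x < y := by
  obtain ⟨a, b, hab⟩ := exists_pair_lt X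
  obtain ⟨g, hg⟩ := hX a x
  exact ⟨g b, hg ▸ g.strictMono hab⟩

theorem IsRigidChain.isHomogeneousChain (hr : IsRigidChain X) : IsHomogeneousChain X :=
  fun x y => (hr x y).exists

/-- On a rigid chain, the sets `V = {g | g x < y}` with `x < y` are bounded above in the ordered
group `Aut(X)`. So finitely many sets `V g V` cannot cover it. -/
theorem IsRigidChain.not_isRoelckePrecompact [Nontrivial X] (hr : IsRigidChain X)
    {τ : GroupTopology (X ≃o X)}
    (hτ : ∀ x y : X, IsOpen[τ.toTopologicalSpace] {g : X ≃o X | g x < y}) :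
    ¬ τ.IsRoelckePrecompact := by
  let := τ.toTopologicalSpace
  have := τ.toIsTopologicalGroup
  have hX := hr.isHomogeneousChain
  intro h
  rw [GroupTopology.isRoelckePrecompact_iff] at h
  obtain ⟨x⟩ := (inferInstance : Nonempty X)
  obtain ⟨y, hxy⟩ := hX.exists_gt x
  have hV : {g : X ≃o X | g x < y} ∈ 𝓝 1 := (hτ x y).mem_nhds hxy
  obtain ⟨t, ht, hcov⟩ := h _ (inv_mem_nhds_one _ hV)
  obtain ⟨b, hb⟩ := hX x y
  have hbound : ∀ v ∈ {g : X ≃o X | g x < y}, ∀ z, v z ≤ b z := fun v hv z =>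
    hr.le_of_apply_le (x := x) (hb.symm ▸ (le_of_lt hv)) z
  obtain ⟨M, hM⟩ : ∃ M, ∀ f ∈ t, b (f (b x)) ≤ M := by
    obtain ⟨M, hM⟩ := (ht.image fun f : X ≃o X => b (f (b x))).bddAbove
    exact ⟨M, fun f hf => hM ⟨f, hf, rfl⟩⟩
  obtain ⟨M', hM'⟩ := hX.exists_gt M
  obtain ⟨g, hg⟩ := hX x M'
  obtain ⟨f, hf, v, hv, w, hw, rfl⟩ := hcov g
  have h1 : M' = v⁻¹ ((v * g * w) (w⁻¹ x)) := by
    rw [← hg]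
    change g x = v⁻¹ (v (g (w (w⁻¹ x))))
    rw [RelIso.apply_inv_self, RelIso.inv_apply_self]
  refine absurd hM' (not_lt.2 ?_)
  rw [h1]
  refine le_trans ?_ (hM _ hf)
  exact (hbound _ hv _).trans (b.monotone ((v * g * w).monotone (hbound _ hw _)))

/-! ### Ultrahomogeneous chains are Roelcke precompact in the permutation topology -/

theorem IsUltrahomogeneousChain.exists_eqOn (hu : IsUltrahomogeneousChain X) (A : Finset X)
    {φ : X → X} (hφ : StrictMonoOn φ A) : ∃ u : X ≃o X, ∀ a ∈ A, u a = φ a := by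
  obtain ⟨u, hu⟩ := hu A.card (A.orderEmbOfFin rfl) (φ ∘ A.orderEmbOfFin rfl)
    (A.orderEmbOfFin rfl).strictMono fun i j hij =>
      hφ (A.orderEmbOfFin_mem rfl i) (A.orderEmbOfFin_mem rfl j)
        ((A.orderEmbOfFin rfl).strictMono hij)
  refine ⟨u, fun a ha => ?_⟩
  have : a ∈ range (A.orderEmbOfFin rfl) := by simpa using ha
  obtain ⟨i, rfl⟩ := this
  exact hu i

/-- If `g F` and `h F` lie in the same way with respect to the finite set `F`, then `g` and `h`
belong to the same double coset of the pointwise stabilizer of `F`. -/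
theorem IsUltrahomogeneousChain.exists_eq_mul (hu : IsUltrahomogeneousChain X) (F : Finset X)
    {g h : X ≃o X} (h1 : ∀ x ∈ F, ∀ y ∈ F, g x < y ↔ h x < y)
    (h2 : ∀ x ∈ F, ∀ y ∈ F, y < g x ↔ y < h x) :
    ∃ a b : X ≃o X, (∀ x ∈ F, a x = x) ∧ (∀ x ∈ F, b x = x) ∧ h = a * g * b := by
  classical
  -- the identity on `F` and `h * g⁻¹` on `g F`; the two agree on `F ∩ g F`
  let φ : X → X := fun z => if z ∈ F then z else h (g⁻¹ z)
  have hφF : ∀ z ∈ F, φ z = z := fun z hz => if_pos hz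
  have hφg : ∀ x ∈ F, φ (g x) = h x := by
    intro x hx
    by_cases hgx : g x ∈ F
    · rw [hφF _ hgx]
      have h3 := (h1 x hx _ hgx).not.1 (lt_irrefl _)
      have h4 := (h2 x hx _ hgx).not.1 (lt_irrefl _)
      exact le_antisymm (not_lt.1 h3) (not_lt.1 h4)
    · change (if g x ∈ F then g x else h (g⁻¹ (g x))) = h x
      rw [if_neg hgx, RelIso.inv_apply_self]
  obtain ⟨u, hu⟩ := hu.exists_eqOn (F ∪ F.image g) (φ := φ) (by
    intro p hp q hq hpq
    simp only [Finset.coe_union, Finset.coe_image, mem_union, Finset.mem_coe, mem_image] at hp hq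
    rcases hp with hp | ⟨x, hx, rfl⟩ <;> rcases hq with hq | ⟨y, hy, rfl⟩
    · rwa [hφF p hp, hφF q hq]
    · rw [hφF p hp, hφg y hy]
      exact (h2 y hy p hp).1 hpq
    · rw [hφF q hq, hφg x hx]
      exact (h1 x hx q hq).1 hpq
    · rw [hφg x hx, hφg y hy]
      exact h.strictMono (g.lt_iff_lt.1 hpq))
  refine ⟨u, (u * g)⁻¹ * h, fun x hx => ?_, fun x hx => ?_, ?_⟩
  · rw [hu x (Finset.mem_union_left _ hx), hφF x hx]
  · have h3 : (u * g) x = h x :=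
      (hu (g x) (Finset.mem_union_right _ (Finset.mem_image_of_mem g hx))).trans (hφg x hx)
    change (u * g)⁻¹ (h x) = x
    rw [← h3, RelIso.inv_apply_self]
  · rw [mul_inv_cancel_left]

theorem permTopology_hasBasis_nhds_one (X : Type*) [LinearOrder X] :
    (@nhds (X ≃o X) (permTopology X).toTopologicalSpace 1).HasBasis (fun F : Set X => F.Finite)
      fun F => {g : X ≃o X | ∀ x ∈ F, g x = x} := by
  have h : @nhds (X ≃o X) (permTopology X).toTopologicalSpace 1 =
      ⨅ x : X, 𝓟 {g : X ≃o X | g x = x} := by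
    change @nhds (X ≃o X) (autPointwise X ⊥) 1 = _
    rw [nhds_iInf]
    refine iInf_congr fun x => ?_
    rw [@nhds_induced _ _ ⊥, @nhds_discrete X ⊥ (discreteTopology_bot X),
      ← principal_singleton, comap_principal]
    rfl
  rw [h]
  convert hasBasis_iInf_principal_finite fun x : X => {g : X ≃o X | g x = x} using 2 with F
  ext g
  simp

theorem IsUltrahomogeneousChain.isRoelckePrecompact_permTopology
    (hu : IsUltrahomogeneousChain X) : (permTopology X).IsRoelckePrecompact := by
  rw [GroupTopology.isRoelckePrecompact_iff]
  intro V hV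
  obtain ⟨F, hF, hFV⟩ := (permTopology_hasBasis_nhds_one X).mem_iff.1 hV
  have := hF.to_subtype
  -- the position of `g F` relative to `F`
  let π : (X ≃o X) → F → F → Prop × Prop := fun g x y => (g x < y, (y : X) < g x)
  refine ⟨range (rangeSplitting π), finite_range _, fun g => ?_⟩
  refine ⟨_, mem_range_self ⟨π g, mem_range_self g⟩, ?_⟩
  have hπ := apply_rangeSplitting π ⟨π g, mem_range_self g⟩
  have hpat : ∀ (x y : F), π g x y = π (rangeSplitting π ⟨π g, mem_range_self g⟩) x y :=
    fun x y => (congrFun₂ hπ x y).symm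
  obtain ⟨a, b, ha, hb, hab⟩ := hu.exists_eq_mul hF.toFinset
    (fun x hx y hy => iff_of_eq (congrArg Prod.fst
      (hpat ⟨x, hF.mem_toFinset.1 hx⟩ ⟨y, hF.mem_toFinset.1 hy⟩)))
    (fun x hx y hy => iff_of_eq (congrArg Prod.snd
      (hpat ⟨x, hF.mem_toFinset.1 hx⟩ ⟨y, hF.mem_toFinset.1 hy⟩)))
  exact ⟨a, hFV fun x hx => ha x (hF.mem_toFinset.2 hx), b,
    hFV fun x hx => hb x (hF.mem_toFinset.2 hx), hab⟩

/-! ### Admissible topologies and homogeneous GO-spaces -/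

/-- A point of a GO-space has neighbourhoods `[a, b]` with end points in any given neighbourhood `O`:
`a < x` if `O` has points below `x`, and `a = x` otherwise; similarly for `b`. -/
theorem exists_Icc_mem_nhds {σ : TopologicalSpace X} (hσ : σ ≤ Preorder.topology X) {O : Set X}
    {x : X} (hO : O ∈ @nhds X σ x) :
    ∃ a ∈ O, ∃ b ∈ O, Icc a b ∈ @nhds X σ x := by
  have hxO : x ∈ O := mem_of_mem_nhds hO
  have hIoi : ∀ a < x, Ioi a ∈ @nhds X σ x := fun a ha =>
    (hσ _ (TopologicalSpace.isOpen_generateFrom_of_mem ⟨a, Or.inl rfl⟩)).mem_nhds ha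
  have hIio : ∀ b, x < b → Iio b ∈ @nhds X σ x := fun b hb =>
    (hσ _ (TopologicalSpace.isOpen_generateFrom_of_mem ⟨b, Or.inr rfl⟩)).mem_nhds hb
  obtain ⟨a, haO, ha⟩ : ∃ a ∈ O, Ici a ∈ @nhds X σ x := by
    by_cases h : ∃ a ∈ O, a < x
    · obtain ⟨a, haO, hax⟩ := h
      exact ⟨a, haO, mem_of_superset (hIoi a hax) Ioi_subset_Ici_self⟩
    · push Not at h
      exact ⟨x, hxO, mem_of_superset hO h⟩
  obtain ⟨b, hbO, hb⟩ : ∃ b ∈ O, Iic b ∈ @nhds X σ x := by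
    by_cases h : ∃ b ∈ O, x < b
    · obtain ⟨b, hbO, hxb⟩ := h
      exact ⟨b, hbO, mem_of_superset (hIio b hxb) Iio_subset_Iic_self⟩
    · push Not at h
      exact ⟨x, hxO, mem_of_superset hO h⟩
  exact ⟨a, haO, b, hbO, inter_mem ha hb⟩

theorem isAdmissible_permTopology {σ : TopologicalSpace X} (hσ : IsHomogeneousGOTopology σ) :
    IsAdmissible σ (permTopology X) := by
  obtain ⟨⟨hle, B, hconv, hB⟩, hcont⟩ := hσ
  let : TopologicalSpace (X ≃o X) := (permTopology X).toTopologicalSpace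
  change Continuous fun p : (X ≃o X) × X => p.1 p.2
  rw [continuous_iff_continuousAt]
  rintro ⟨g, x⟩ W hW
  obtain ⟨U, hU, hxU, hUW⟩ := hB.mem_nhds_iff.1 hW
  have hO : g ⁻¹' U ∈ 𝓝 x := ((hB.isOpen hU).preimage (hcont g)).mem_nhds hxU
  obtain ⟨a, ha, b, hb, hab⟩ := exists_Icc_mem_nhds hle hO
  have hev : ∀ z : X, {f : X ≃o X | f z = g z} ∈ 𝓝 g := by
    intro z
    have hz : @Continuous _ _ (permTopology X).toTopologicalSpace ⊥ fun f : X ≃o X => f z :=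
      continuous_autPointwise_apply (σ := ⊥) z
    exact (@Continuous.isOpen_preimage _ _ _ ⊥ _ hz {g z} trivial).mem_nhds rfl
  refine mem_map.2 (mem_of_superset (prod_mem_nhds (inter_mem (hev a) (hev b)) hab) ?_)
  rintro ⟨f, z⟩ ⟨⟨hfa, hfb⟩, hz⟩
  refine hUW ((hconv U hU).out ha hb ⟨?_, ?_⟩)
  · exact (show f a = g a from hfa) ▸ f.monotone hz.1
  · exact (show f b = g b from hfb) ▸ f.monotone hz.2

theorem IsAdmissible.isOpen_setOf_apply_lt {σ : TopologicalSpace X} (hσ : IsGOTopology σ)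
    {τ : GroupTopology (X ≃o X)} (hτ : IsAdmissible σ τ) (x y : X) :
    IsOpen[τ.toTopologicalSpace] {g : X ≃o X | g x < y} := by
  let := τ.toTopologicalSpace
  have h1 : Continuous fun p : (X ≃o X) × X => p.1 p.2 := hτ
  have h2 : Continuous fun g : X ≃o X => g x := h1.comp (Continuous.prodMk_left x)
  exact (hσ.1 _ (TopologicalSpace.isOpen_generateFrom_of_mem ⟨y, Or.inr rfl⟩)).preimage h2

theorem isHomogeneousGOTopology_order (X : Type*) [LinearOrder X] :
    IsHomogeneousGOTopology (Preorder.topology X) := by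
  let : TopologicalSpace X := Preorder.topology X
  have : OrderTopology X := ⟨rfl⟩
  refine ⟨⟨le_rfl, _, ?_, TopologicalSpace.isTopologicalBasis_of_subbasis rfl⟩,
    fun g => g.continuous⟩
  rintro _ ⟨f, ⟨-, hf⟩, rfl⟩
  refine ordConnected_sInter fun s hs => ?_
  rcases hf hs with ⟨a, rfl | rfl⟩
  exacts [ordConnected_Ioi, ordConnected_Iio]

theorem isUltrahomogeneousChain_of_subsingleton [Subsingleton X] : IsUltrahomogeneousChain X :=
  fun _ _ _ _ _ => ⟨1, fun _ => Subsingleton.elim _ _⟩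

theorem isOpen_pointwiseTopology_setOf_apply_lt (x y : X) :
    IsOpen[(pointwiseTopology X).toTopologicalSpace] {g : X ≃o X | g x < y} := by
  have h : @Continuous _ _ (pointwiseTopology X).toTopologicalSpace (Preorder.topology X)
      fun g : X ≃o X => g x := continuous_autPointwise_apply x
  exact @Continuous.isOpen_preimage _ _ (_) (_) _ h _
    (TopologicalSpace.isOpen_generateFrom_of_mem ⟨y, Or.inr rfl⟩)

theorem permTopology_le_pointwiseTopology (X : Type*) [LinearOrder X] :
    (permTopology X).toTopologicalSpace ≤ (pointwiseTopology X).toTopologicalSpace :=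
  iInf_mono fun _ => induced_mono bot_le

end

theorem mainTheorem1 (X : Type*) [LinearOrder X] [Nonempty X] (hX : IsSimpleChain X) :
    -- (1), on all homogeneous GO-spaces together, and on each of them separately
    (Nontrivial X →
      (IsRigidChain X ↔
        ∀ σ : TopologicalSpace X, IsHomogeneousGOTopology σ →
          ∀ τ : GroupTopology (X ≃o X), IsAdmissible σ τ → ¬ τ.IsRoelckePrecompact) ∧
      ∀ σ : TopologicalSpace X, IsHomogeneousGOTopology σ →
        (IsRigidChain X ↔
          ∀ τ : GroupTopology (X ≃o X), IsAdmissible σ τ → ¬ τ.IsRoelckePrecompact)) ∧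
    -- (2)
    ((IsUltrahomogeneousChain X ↔ (permTopology X).IsRoelckePrecompact) ∧
      (IsUltrahomogeneousChain X ↔ (pointwiseTopology X).IsRoelckePrecompact)) ∧
    -- (3)
    ((permTopology X).IsRoelckePrecompact ↔ (pointwiseTopology X).IsRoelckePrecompact) := by
  have hperm : IsUltrahomogeneousChain X → (permTopology X).IsRoelckePrecompact :=
    IsUltrahomogeneousChain.isRoelckePrecompact_permTopology
  have hmono : (permTopology X).IsRoelckePrecompact → (pointwiseTopology X).IsRoelckePrecompact :=
    fun h => h.mono (permTopology_le_pointwiseTopology X)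
  have hultra : (pointwiseTopology X).IsRoelckePrecompact → IsUltrahomogeneousChain X := by
    intro h
    rcases subsingleton_or_nontrivial X with _ | _
    · exact isUltrahomogeneousChain_of_subsingleton
    · exact hX.isUltrahomogeneousChain fun hr =>
        hr.not_isRoelckePrecompact isOpen_pointwiseTopology_setOf_apply_lt h
  have heach : Nontrivial X → ∀ σ : TopologicalSpace X, IsHomogeneousGOTopology σ →
      (IsRigidChain X ↔
        ∀ τ : GroupTopology (X ≃o X), IsAdmissible σ τ → ¬ τ.IsRoelckePrecompact) := by
    intro _ σ hσ
    refine ⟨fun hr τ hτ => hr.not_isRoelckePrecompact (hτ.isOpen_setOf_apply_lt hσ.1), fun h => ?_⟩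
    by_contra hr
    exact h _ (isAdmissible_permTopology hσ) (hperm (hX.isUltrahomogeneousChain hr))
  refine ⟨fun hnt => ⟨⟨fun hr σ hσ => (heach hnt σ hσ).1 hr, fun h => ?_⟩, heach hnt⟩,
    ⟨⟨hperm, fun h => hultra (hmono h)⟩, ⟨fun h => hmono (hperm h), hultra⟩⟩,
    ⟨hmono, fun h => hperm (hultra h)⟩⟩
  have hσ := isHomogeneousGOTopology_order X
  exact (heach hnt _ hσ).2 (h _ hσ)
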